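/- Let $m$ be a positive integer, $[m]=\{1,\dots,m\}$, and let $\mathcal R=\mathbb F_2[x,y]/\langle x^2,y^2,xy-yx\rangle$, with $u,v$ the classes of $x,y$. Put $\mathbf b_1=1+u+v$, $\mathbf b_2=u+v$, $\mathbf b_3=u$, $\mathbf b_4=uv$. For $S\subseteq[m]$ let $\Delta_S=\{w\in\mathbb F_2^m:\operatorname{Supp}(w)\subseteq S\}$ and $\Delta_S^c=\mathbb F_2^m\setminus\Delta_S$. For a finite set $D=\{d_1,\dots,d_n\}\subseteq\mathcal R^m$ (with $d_1,\dots,d_n$ distinct) let $\mathcal C_D=\{(\mathbf z\cdot d_1,\dots,\mathbf z\cdot d_n):\mathbf z\in\mathcal R^m\}\subseteq\mathcal R^n$, and let its subfield code $\mathcal C_D^{(2)}\subseteq\mathbb F_2^n$ be the binary linear code generated by the matrix obtained from a generator matrix of $\mathcal C_D$ by replacing each entry by the column of its coordinates with respect to an $\mathbb F_2$-basis of $\mathcal R$ (any generator matrix and any basis may be used). A linear code $C$ is minimal if, for all $c,w\in C$ with $c\neq0$ and $\operatorname{Supp}(c)\subseteq\operatorname{Supp}(w)$, $w$ is a nonzero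 scalar multiple of $c$; it is self-orthogonal if $c\cdot w=0$ for all $c,w\in C$. **Theorem.** Let $X_1,X_2,X_3,X_4\subseteq[m]$ (called $X,Y,Z,W$). 1. Let $T\subseteq\{1,2,3,4\}$ and $D=\mathbf b_1A_1+\mathbf b_2A_2+\mathbf b_3A_3+\mathbf b_4A_4$, where $A_i=\Delta_{X_i}^c$ for $i\in T$ and $A_i=\Delta_{X_i}$ for $i\notin T$. - If $|X_i|\le m-2$ for all $i\in T$ (no condition when $T=\emptyset$), then $\mathcal C_D^{(2)}$ is minimal. - If $T\ne\{1,2,3,4\}$ and $\sum_{i\notin T}|X_i|\ge3$, then $\mathcal C_D^{(2)}$ is self-orthogonal. - If $T=\{1,2,3,4\}$ and $X_1,X_2,X_3,X_4$ are all non-empty, then $\mathcal C_D^{(2)}$ is self-orthogonal. 2. Let $D=\mathcal R^m\setminus(\mathbf b_1\Delta_{X_1}+\mathbf b_2\Delta_{X_2}+\mathbf b_3\Delta_{X_3}+\mathbf b_4\Delta_{X_4})$. - If $|X_1|+|X_2|+|X_3|+|X_4|\le4m-2$, then $\mathcal C_D^{(2)}$ is minimal. - If $|X_1|+|X_2|+|X_3|+|X_4|\ge3$,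 then $\mathcal C_D^{(2)}$ is self-orthogonal. -/

import Mathlib

namespace SubfieldCodes

noncomputable section

open MvPolynomial

/-- The commutative `𝔽₂`-algebra `𝓡 = 𝔽₂[x, y] / ⟨x², y², xy - yx⟩`. -/
abbrev 𝓡 : Type :=
  MvPolynomial (Fin 2) (ZMod 2) ⧸
    (Ideal.span {X 0 ^ 2, X 1 ^ 2, X 0 * X 1 - X 1 * X 0} :
      Ideal (MvPolynomial (Fin 2) (ZMod 2)))

/-- The class of `x` in `𝓡`. -/
def u : 𝓡 := Ideal.Quotient.mk _ (X 0)

/-- The class of `y` in `𝓡`. -/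
def v : 𝓡 := Ideal.Quotient.mk _ (X 1)

/-- `b₁ = 1 + u + v`. -/
def b₁ : 𝓡 := 1 + u + v

/-- `b₂ = u + v`. -/
def b₂ : 𝓡 := u + v

/-- `b₃ = u`. -/
def b₃ : 𝓡 := u

/-- `b₄ = uv`. -/
def b₄ : 𝓡 := u * v

/-- `Δ_S`, the simplicial complex generated by `S ⊆ [m]`: the vectors of `𝔽₂ᵐ` with support
contained in `S`. -/
def Δ {m : ℕ} (S : Finset (Fin m)) : Set (Fin m → ZMod 2) :=
  {w | Function.support w ⊆ (S : Set (Fin m))}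

/-- The set `b₁A₁ + b₂A₂ + b₃A₃ + b₄A₄ ⊆ 𝓡ᵐ`, for `A₁, A₂, A₃, A₄ ⊆ 𝔽₂ᵐ`. -/
def combine {m : ℕ} (A₁ A₂ A₃ A₄ : Set (Fin m → ZMod 2)) : Set (Fin m → 𝓡) :=
  {d | ∃ a₁ ∈ A₁, ∃ a₂ ∈ A₂, ∃ a₃ ∈ A₃, ∃ a₄ ∈ A₄,
    d = fun i => a₁ i • b₁ + a₂ i • b₂ + a₃ i • b₃ + a₄ i • b₄}

/-- `d = (d₁, …, dₙ)` lists the elements of `D`, each exactly once. -/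
def IsEnumeration {m n : ℕ} (d : Fin n → Fin m → 𝓡) (D : Set (Fin m → 𝓡)) : Prop :=
  Function.Injective d ∧ Set.range d = D

/-- The code `C_D = {(z·d₁, …, z·dₙ) : z ∈ 𝓡ᵐ}` over `𝓡`, where `D` is listed as
`d₁, …, dₙ`. -/
def codeOf {m n : ℕ} (d : Fin n → Fin m → 𝓡) : Submodule 𝓡 (Fin n → 𝓡) where
  carrier := {c | ∃ z : Fin m → 𝓡, c = fun j => z ⬝ᵥ d j}
  add_mem' := by
    rintro _ _ ⟨z, rfl⟩ ⟨z', rfl⟩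
    exact ⟨z + z', by funext j; simp [add_dotProduct]⟩
  zero_mem' := ⟨0, by funext j; simp⟩
  smul_mem' := by
    rintro r _ ⟨z, rfl⟩
    exact ⟨r • z, by funext j; simp [smul_dotProduct]⟩

/-- `G` is a generator matrix of the code `C` over `𝓡`: its rows generate `C`. -/
def IsGeneratorMatrix {k n : ℕ} (G : Matrix (Fin k) (Fin n) 𝓡)
    (C : Submodule 𝓡 (Fin n → 𝓡)) : Prop :=
  Submodule.span 𝓡 (Set.range fun r => G r) = C

/-- The binary code generated by the matrix obtained from `G` on replacing each entry by the
column of its coordinates in the `𝔽₂`-basis `B` of `𝓡`; its rows are indexed by pairs `(r, i)`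
of a row `r` of `G` and an index `i` of `B`.  If `G` is a generator matrix of `C`, this is the
subfield code `C⁽²⁾`. -/
def subfieldCode {ι : Type*} {k n : ℕ} (B : Module.Basis ι (ZMod 2) 𝓡)
    (G : Matrix (Fin k) (Fin n) 𝓡) : Submodule (ZMod 2) (Fin n → ZMod 2) :=
  Submodule.span (ZMod 2) (Set.range fun p : Fin k × ι => fun j => B.repr (G p.1 j) p.2)

/-- A linear code is minimal if a codeword that covers a nonzero codeword `c` (that is, whose
support contains that of `c`) is always a nonzero scalar multiple of `c`. -/
def IsMinimalCode {F : Type*} [Field F] {n : ℕ} (C : Submodule F (Fin n → F)) : Prop :=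
  ∀ c ∈ C, c ≠ 0 → ∀ w ∈ C, Function.support c ⊆ Function.support w → ∃ a : F, a ≠ 0 ∧ w = a • c

/-- A linear code is (Euclidean) self-orthogonal if `C ⊆ C^⊥`. -/
def IsSelfOrthogonal {F : Type*} [Field F] {n : ℕ} (C : Submodule F (Fin n → F)) : Prop :=
  ∀ c ∈ C, ∀ w ∈ C, c ⬝ᵥ w = 0

end

end SubfieldCodes

open SubfieldCodes

namespace SubfieldCodes

noncomputable section

open scoped Pointwise

/-! Every codeword of the subfield code is j ↦ f(d_j) for an 𝔽₂-linear functional f on 𝓡ᵐ, so both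
claims concern pairs (f, g) restricted to D.

Minimality: if f and f - g are both not identically zero on D, some point of D must satisfy f = 1, g
= 0. This holds when (f, g) maps D onto a tame subset of 𝔽₂² (`IsTame.one_zero_mem`). Having only
tame images passes to sums and linear images, hence to `combine`; subspaces have it, and so do
complements of subspaces of codimension at least 2 (`HasTameImages.compl_submodule`).

Self-orthogonality: D is stable under translation by b₁Δ_X + b₂Δ_Y + b₃Δ_Z + b₄Δ_W. If this space
has dimension at least 3, it contains a nonzero vector killed by f and g; translation by it pairs
off the terms of the inner product. -/

/-- A subset of `𝔽₂²` is tame if it is a subspace or the set of all nonzero vectors. -/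
def IsTame (S : Set (ZMod 2 × ZMod 2)) : Prop :=
  (∃ H : Submodule (ZMod 2) (ZMod 2 × ZMod 2), S = H) ∨ S = {0}ᶜ

theorem add_mem_nonzero_sumset : ∀ s t : ZMod 2 × ZMod 2, t ≠ 0 → ∃ r, r ≠ 0 ∧
    (r = s ∨ r + t = s) := by decide

theorem exists_ne_zero_add : ∀ s : ZMod 2 × ZMod 2, ∃ r r', r ≠ 0 ∧ r' ≠ 0 ∧ r + r' = s := by
  decide

/-- Adding the zero subspace changes nothing; adding any larger one fills the plane. -/
theorem IsTame.compl_zero_add_submodule (H : Submodule (ZMod 2) (ZMod 2 × ZMod 2)) :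
    IsTame ({0}ᶜ + (H : Set (ZMod 2 × ZMod 2))) := by
  by_cases hH : H = ⊥
  · right
    subst hH
    simp
  · left
    obtain ⟨t, htH, ht⟩ := H.ne_bot_iff.1 hH
    refine ⟨⊤, Set.eq_univ_of_forall fun s => ?_⟩
    obtain ⟨r, hr, h | h⟩ := add_mem_nonzero_sumset s t ht
    · exact ⟨r, hr, 0, H.zero_mem, by simpa using h⟩
    · exact ⟨r, hr, t, htH, h⟩

theorem IsTame.add {S T : Set (ZMod 2 × ZMod 2)} (hS : IsTame S) (hT : IsTame T) :
    IsTame (S + T) := by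
  rcases hS with ⟨H, rfl⟩ | rfl <;> rcases hT with ⟨K, rfl⟩ | rfl
  · exact Or.inl ⟨H ⊔ K, (Submodule.coe_sup H K).symm⟩
  · rw [add_comm]
    exact IsTame.compl_zero_add_submodule H
  · exact IsTame.compl_zero_add_submodule K
  · refine Or.inl ⟨⊤, Set.eq_univ_of_forall fun s => ?_⟩
    obtain ⟨r, r', hr, hr', h⟩ := exists_ne_zero_add s
    exact ⟨r, hr, r', hr', h⟩

theorem IsTame.one_zero_mem {S : Set (ZMod 2 × ZMod 2)} (hS : IsTame S)
    (h₁ : ∃ s ∈ S, s.1 ≠ 0) (h₂ : ∃ s ∈ S, s.1 ≠ s.2) : ((1, 0) : ZMod 2 × ZMod 2) ∈ S := by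
  rcases hS with ⟨H, rfl⟩ | rfl
  · obtain ⟨s, hs, hs1⟩ := h₁
    obtain ⟨t, ht, htt⟩ := h₂
    -- If neither vector is (1, 0), they are (1, 1) and (0, 1), whose sum is (1, 0).
    have key : ∀ s t : ZMod 2 × ZMod 2, s.1 ≠ 0 → t.1 ≠ t.2 →
        (1, 0) = s ∨ (1, 0) = t ∨ (1, 0) = s + t := by decide
    rcases key s t hs1 htt with h | h | h <;> rw [h]
    · exact hs
    · exact ht
    · exact H.add_mem hs ht
  · simp

/-! ### Sets with tame images in the plane -/

section Tame

variable {E F : Type*} [AddCommGroup E] [Module (ZMod 2) E] [AddCommGroup F] [Module (ZMod 2) F]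

/-- A set is tame if its image under every linear map to `𝔽₂²` is. -/
def HasTameImages (A : Set E) : Prop :=
  ∀ φ : E →ₗ[ZMod 2] ZMod 2 × ZMod 2, IsTame (φ '' A)

theorem HasTameImages.submodule (U : Submodule (ZMod 2) E) : HasTameImages (U : Set E) :=
  fun φ => Or.inl ⟨U.map φ, (Submodule.map_coe φ U).symm⟩

theorem HasTameImages.add {A B : Set E} (hA : HasTameImages A) (hB : HasTameImages B) :
    HasTameImages (A + B) := fun φ => by
  rw [Set.image_add]
  exact (hA φ).add (hB φ)

theorem HasTameImages.image {A : Set E} (hA : HasTameImages A) (ψ : E →ₗ[ZMod 2] F) :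
    HasTameImages (ψ '' A) := fun φ => by
  have := hA (φ ∘ₗ ψ)
  rwa [LinearMap.coe_comp, Set.image_comp] at this

/-- If ker φ = U, the codimension bound makes φ onto, and removing U removes exactly the value 0.
Otherwise no value of φ is lost. -/
theorem HasTameImages.compl_submodule [Module.Finite (ZMod 2) E] (U : Submodule (ZMod 2) E)
    (hU : Module.finrank (ZMod 2) U + 2 ≤ Module.finrank (ZMod 2) E) :
    HasTameImages (U : Set E)ᶜ := fun φ => by
  have hrk := φ.finrank_range_add_finrank_ker
  have hF : Module.finrank (ZMod 2) (ZMod 2 × ZMod 2) = 2 := by simp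
  by_cases hK : LinearMap.ker φ = U
  · right
    have htop : LinearMap.range φ = ⊤ := by
      apply Submodule.eq_top_of_finrank_eq
      have := (LinearMap.range φ).finrank_le
      rw [hK] at hrk
      omega
    ext s
    simp only [Set.mem_image, Set.mem_compl_iff, SetLike.mem_coe, Set.mem_singleton_iff, ← hK,
      LinearMap.mem_ker]
    constructor
    · rintro ⟨x, hx, rfl⟩
      exact hx
    · intro hs
      obtain ⟨x, rfl⟩ := LinearMap.range_eq_top.1 htop s
      exact ⟨x, hs, rfl⟩
  · left
    refine ⟨LinearMap.range φ, Set.Subset.antisymm ?_ ?_⟩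
    · rintro _ ⟨x, -, rfl⟩
      exact ⟨x, rfl⟩
    · rintro _ ⟨a, rfl⟩
      by_contra hcon
      -- A lost value has its whole fibre a + ker φ inside U. Then ker φ ≤ U, and since ker φ has
      -- codimension at most 2, the two are equal.
      have hmem : ∀ k ∈ LinearMap.ker φ, a + k ∈ U := by
        intro k hk
        by_contra hk'
        exact hcon ⟨a + k, hk', by rw [map_add, LinearMap.mem_ker.1 hk, add_zero]⟩
      have ha : a ∈ U := by simpa using hmem 0 (Submodule.zero_mem _)
      have hle : LinearMap.ker φ ≤ U := fun k hk => by
        simpa using U.sub_mem (hmem k hk) ha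
      refine hK (Submodule.eq_of_le_of_finrank_le hle ?_)
      have := (LinearMap.range φ).finrank_le
      omega

end Tame

/-! ### Codes given by evaluating functionals -/

section Functionals

variable {E : Type*} [AddCommGroup E] [Module (ZMod 2) E] {n : ℕ} {d : Fin n → E}
  {C : Submodule (ZMod 2) (Fin n → ZMod 2)}

theorem isMinimalCode_of_hasTameImages
    (hC : ∀ c ∈ C, ∃ L : E →ₗ[ZMod 2] ZMod 2, c = fun j => L (d j))
    (hd : HasTameImages (Set.range d)) : IsMinimalCode C := by
  intro c hc hc0 w hw hsupp
  refine ⟨1, one_ne_zero, ?_⟩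
  rw [one_smul]
  obtain ⟨f, rfl⟩ := hC c hc
  obtain ⟨g, rfl⟩ := hC w hw
  by_contra hne
  obtain ⟨i, hi⟩ := Function.ne_iff.1 hc0
  obtain ⟨j, hj⟩ := Function.ne_iff.1 hne
  obtain ⟨_, ⟨l, rfl⟩, hl⟩ := (hd (f.prod g)).one_zero_mem
    ⟨_, ⟨_, ⟨i, rfl⟩, rfl⟩, hi⟩ ⟨_, ⟨_, ⟨j, rfl⟩, rfl⟩, fun h => hj h.symm⟩
  have h1 : f (d l) = 1 := congrArg Prod.fst hl
  have h2 : g (d l) = 0 := congrArg Prod.snd hl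
  exact hsupp (a := l) (by simp [h1]) h2

/-- A code given by evaluating functionals on a set stable under the translations by a space of
dimension at least three is self-orthogonal. -/
theorem isSelfOrthogonal_of_add_mem
    (hC : ∀ c ∈ C, ∃ L : E →ₗ[ZMod 2] ZMod 2, c = fun j => L (d j))
    (hd : Function.Injective d) {K : Type*} [AddCommGroup K] [Module (ZMod 2) K]
    [Module.Finite (ZMod 2) K] (hK : 3 ≤ Module.finrank (ZMod 2) K)
    (ψ : K →ₗ[ZMod 2] E) (hψ : Function.Injective ψ)
    (h : ∀ x ∈ Set.range d, ∀ k, x + ψ k ∈ Set.range d) : IsSelfOrthogonal C := by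
  intro c hc w hw
  obtain ⟨f, rfl⟩ := hC c hc
  obtain ⟨g, rfl⟩ := hC w hw
  -- Two functionals on a space of dimension at least 3 have a common nonzero zero.
  have hker : LinearMap.ker (f.prod g ∘ₗ ψ) ≠ ⊥ :=
    LinearMap.ker_ne_bot_of_finrank_lt (by simp; omega)
  obtain ⟨k, hk, hk0⟩ := Submodule.exists_mem_ne_zero_of_ne_bot hker
  have hf : f (ψ k) = 0 := congrArg Prod.fst hk
  have hg : g (ψ k) = 0 := congrArg Prod.snd hk
  have hex : ∀ j, ∃ j', d j' = d j + ψ k := fun j => h _ ⟨j, rfl⟩ k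
  -- Translation by `ψ k` permutes the indices as a fixed-point-free involution preserving each
  -- product, so the terms cancel in pairs in characteristic 2.
  choose σ hσ using hex
  refine Finset.sum_involution (fun j _ => σ j) ?_ ?_ (fun _ _ => Finset.mem_univ _) ?_
  · intro j _
    simp only [hσ, map_add, hf, hg, add_zero]
    exact CharTwo.add_self_eq_zero _
  · intro j _ _ hj
    have := hσ j
    rw [hj, left_eq_add] at this
    exact hk0 (hψ (by rw [this, map_zero]))
  · intro j _
    apply hd
    rw [hσ, hσ, add_assoc, ZModModule.add_self, add_zero]

end Functionals

/-! ### b₁, b₂, b₃, b₄ form an 𝔽₂-basis of 𝓡 -/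

section Ring

/-- The linear combination of `b₁, b₂, b₃, b₄` with given coefficients. -/
def ofCoords : ZMod 2 × ZMod 2 × ZMod 2 × ZMod 2 →ₗ[ZMod 2] 𝓡 :=
  (LinearMap.toSpanSingleton (ZMod 2) 𝓡 b₁).coprod <|
    (LinearMap.toSpanSingleton (ZMod 2) 𝓡 b₂).coprod <|
      (LinearMap.toSpanSingleton (ZMod 2) 𝓡 b₃).coprod <|
        LinearMap.toSpanSingleton (ZMod 2) 𝓡 b₄

theorem ofCoords_apply (a b c e : ZMod 2) :
    ofCoords (a, b, c, e) = a • b₁ + b • b₂ + c • b₃ + e • b₄ := by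
  simp [ofCoords, add_assoc]

theorem u_mul_self : u * u = 0 := by
  rw [u, ← map_mul, Ideal.Quotient.eq_zero_iff_mem, ← pow_two]
  exact Ideal.subset_span (by simp)

theorem v_mul_self : v * v = 0 := by
  rw [v, ← map_mul, Ideal.Quotient.eq_zero_iff_mem, ← pow_two]
  exact Ideal.subset_span (by simp)

/-- The map from `𝔽₂[x, y]` to the dual numbers over the dual numbers over `𝔽₂`. -/
def polyToDual : MvPolynomial (Fin 2) (ZMod 2) →ₐ[ZMod 2] DualNumber (DualNumber (ZMod 2)) :=
  MvPolynomial.aeval (S₁ := DualNumber (DualNumber (ZMod 2)))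
    ![TrivSqZeroExt.inl DualNumber.eps, DualNumber.eps]

/-- The map from `𝓡` to the dual numbers over the dual numbers over `𝔽₂`. -/
def toDual : 𝓡 →ₐ[ZMod 2] DualNumber (DualNumber (ZMod 2)) :=
  Ideal.Quotient.liftₐ _ polyToDual <| by
    intro a ha
    rw [← RingHom.mem_ker]
    refine (Ideal.span_le.2 ?_) ha
    rintro _ (rfl | rfl | rfl)
    · simp [polyToDual, RingHom.mem_ker, pow_two, ← TrivSqZeroExt.inl_mul]
    · simp [polyToDual, RingHom.mem_ker, pow_two]
    · simp [mul_comm]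

theorem toDual_u : toDual u = TrivSqZeroExt.inl DualNumber.eps := by
  change polyToDual (MvPolynomial.X 0) = _
  simp [polyToDual]

theorem toDual_v : toDual v = DualNumber.eps := by
  change polyToDual (MvPolynomial.X 1) = _
  simp [polyToDual]

/-- The iterated dual numbers have four visible components, which separate 1, u, v and uv. -/
theorem ofCoords_injective : Function.Injective ofCoords := by
  rw [← LinearMap.ker_eq_bot, LinearMap.ker_eq_bot']
  rintro ⟨a, b, c, e⟩ h
  have h' := congrArg toDual h
  rw [ofCoords_apply] at h'
  simp only [map_add, map_smul, b₁, b₂, b₃, b₄, map_mul, map_one, toDual_u, toDual_v,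
    map_zero] at h'
  have h1 := congrArg (fun t => t.fst.fst) h'
  have h2 := congrArg (fun t => t.fst.snd) h'
  have h3 := congrArg (fun t => t.snd.fst) h'
  have h4 := congrArg (fun t => t.snd.snd) h'
  simp at h1 h2 h3 h4
  simp_all

/-- The span of the bᵢ contains 1 = b₁ + b₂ and is closed under multiplication by u and v, so it
contains every polynomial class. -/
theorem ofCoords_surjective : Function.Surjective ofCoords := by
  have hone : (1 : 𝓡) = ofCoords (1, 1, 0, 0) := by
    simp only [ofCoords_apply, b₁, b₂, one_smul, zero_smul, add_zero]
    have : (u + v) + (u + v) = 0 := ZModModule.add_self _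
    rw [add_assoc 1, add_assoc, this, add_zero]
  have hu : ∀ a b c e : ZMod 2, ofCoords (a, b, c, e) * u = ofCoords (0, 0, a, a + b) := by
    intro a b c e
    simp only [ofCoords_apply, b₁, b₂, b₃, b₄, add_mul, smul_mul_assoc, u_mul_self, mul_comm v u,
      mul_right_comm u v u, smul_zero, zero_mul, one_mul, zero_smul, add_smul]
    simp [add_assoc]
  have hv : ∀ a b c e : ZMod 2,
      ofCoords (a, b, c, e) * v = ofCoords (0, a, a, a + b + c) := by
    intro a b c e
    -- Writing v = b₂ + b₃ introduces u twice.
    have huu : a • u + a • u = 0 := ZModModule.add_self _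
    simp only [ofCoords_apply, b₁, b₂, b₃, b₄, add_mul, smul_mul_assoc, v_mul_self,
      mul_assoc u v v, mul_zero, smul_zero, one_mul, zero_smul, add_smul, smul_add]
    linear_combination (norm := module) (-1 : ZMod 2) • huu
  intro r
  obtain ⟨p, rfl⟩ := Ideal.Quotient.mk_surjective r
  induction p using MvPolynomial.induction_on with
  | C a =>
    refine ⟨a • (1, 1, 0, 0), ?_⟩
    rw [map_smul, ← hone, MvPolynomial.C_eq_smul_one]
    rfl
  | add p q hp hq =>
    obtain ⟨x, hx⟩ := hp
    obtain ⟨y, hy⟩ := hq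
    exact ⟨x + y, by rw [map_add, map_add, hx, hy]⟩
  | mul_X p i hp =>
    obtain ⟨⟨a, b, c, e⟩, hx⟩ := hp
    rw [map_mul, ← hx]
    fin_cases i
    · exact ⟨_, (hu a b c e).symm⟩
    · exact ⟨_, (hv a b c e).symm⟩

end Ring

/-! ### Simplicial complexes and the defining sets in 𝓡ᵐ -/

section Combine

variable {m : ℕ}

/-- The map `(a₁, a₂, a₃, a₄) ↦ b₁ a₁ + b₂ a₂ + b₃ a₃ + b₄ a₄` from `(𝔽₂ᵐ)⁴` to `𝓡ᵐ`. -/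
def combineMap (m : ℕ) : (Fin m → ZMod 2) × (Fin m → ZMod 2) × (Fin m → ZMod 2) ×
    (Fin m → ZMod 2) →ₗ[ZMod 2] (Fin m → 𝓡) :=
  LinearMap.pi fun i => ofCoords ∘ₗ
    (LinearMap.proj i).prodMap
      ((LinearMap.proj i).prodMap ((LinearMap.proj i).prodMap (LinearMap.proj i)))

theorem combineMap_apply (a₁ a₂ a₃ a₄ : Fin m → ZMod 2) :
    combineMap m (a₁, a₂, a₃, a₄) =
      fun i => a₁ i • b₁ + a₂ i • b₂ + a₃ i • b₃ + a₄ i • b₄ := by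
  funext i
  exact ofCoords_apply _ _ _ _

theorem combineMap_injective : Function.Injective (combineMap m) := by
  rintro ⟨a₁, a₂, a₃, a₄⟩ ⟨a₁', a₂', a₃', a₄'⟩ h
  have h' : ∀ i, (a₁ i, a₂ i, a₃ i, a₄ i) = (a₁' i, a₂' i, a₃' i, a₄' i) := fun i =>
    ofCoords_injective (congrFun h i)
  simp only [Prod.mk.injEq] at h' ⊢
  exact ⟨funext fun i => (h' i).1, funext fun i => (h' i).2.1, funext fun i => (h' i).2.2.1,
    funext fun i => (h' i).2.2.2⟩

theorem combineMap_surjective : Function.Surjective (combineMap m) := by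
  intro x
  choose y hy using fun i => ofCoords_surjective (x i)
  exact ⟨(fun i => (y i).1, fun i => (y i).2.1, fun i => (y i).2.2.1, fun i => (y i).2.2.2),
    funext hy⟩

instance : Module.Finite (ZMod 2) (Fin m → 𝓡) :=
  Module.Finite.of_surjective _ combineMap_surjective

theorem finrank_pi_ring : Module.finrank (ZMod 2) (Fin m → 𝓡) = 4 * m := by
  rw [← (LinearEquiv.ofBijective (combineMap m)
    ⟨combineMap_injective, combineMap_surjective⟩).finrank_eq]
  simp
  ring

theorem combine_eq_image (A₁ A₂ A₃ A₄ : Set (Fin m → ZMod 2)) :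
    combine A₁ A₂ A₃ A₄ = combineMap m '' (A₁ ×ˢ A₂ ×ˢ A₃ ×ˢ A₄) := by
  ext x
  constructor
  · rintro ⟨a₁, h₁, a₂, h₂, a₃, h₃, a₄, h₄, rfl⟩
    exact ⟨(a₁, a₂, a₃, a₄), ⟨h₁, h₂, h₃, h₄⟩, combineMap_apply _ _ _ _⟩
  · rintro ⟨⟨a₁, a₂, a₃, a₄⟩, ⟨h₁, h₂, h₃, h₄⟩, rfl⟩
    exact ⟨a₁, h₁, a₂, h₂, a₃, h₃, a₄, h₄, combineMap_apply _ _ _ _⟩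

theorem HasTameImages.prod {E F : Type*} [AddCommGroup E] [Module (ZMod 2) E] [AddCommGroup F]
    [Module (ZMod 2) F] {A : Set E} {B : Set F} (hA : HasTameImages A) (hB : HasTameImages B) :
    HasTameImages (A ×ˢ B) := by
  have : A ×ˢ B = LinearMap.inl (ZMod 2) E F '' A + LinearMap.inr (ZMod 2) E F '' B := by
    ext ⟨a, b⟩
    simp [Set.mem_add]
  rw [this]
  exact (hA.image _).add (hB.image _)

theorem HasTameImages.combine {A₁ A₂ A₃ A₄ : Set (Fin m → ZMod 2)} (h₁ : HasTameImages A₁)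
    (h₂ : HasTameImages A₂) (h₃ : HasTameImages A₃) (h₄ : HasTameImages A₄) :
    HasTameImages (combine A₁ A₂ A₃ A₄) := by
  rw [combine_eq_image]
  exact (h₁.prod (h₂.prod (h₃.prod h₄))).image _

/-- Extension by zero, from `𝔽₂^S` to `𝔽₂ᵐ`. -/
def extendZero (S : Finset (Fin m)) : (S → ZMod 2) →ₗ[ZMod 2] (Fin m → ZMod 2) :=
  Function.ExtendByZero.linearMap (ZMod 2) Subtype.val

theorem extendZero_injective (S : Finset (Fin m)) : Function.Injective (extendZero S) := by
  intro f g h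
  funext s
  have := congrFun h s
  simpa [extendZero, Subtype.val_injective.extend_apply] using this

theorem range_extendZero (S : Finset (Fin m)) :
    (LinearMap.range (extendZero S) : Set (Fin m → ZMod 2)) = Δ S := by
  ext x
  constructor
  · rintro ⟨f, rfl⟩ i hi
    by_contra hiS
    refine hi ?_
    simp only [extendZero, Function.ExtendByZero.linearMap_apply]
    exact Function.extend_apply' _ _ _ (by rintro ⟨s, rfl⟩; exact hiS s.2)
  · intro hx
    refine ⟨fun s => x s, ?_⟩
    funext i
    simp only [extendZero, Function.ExtendByZero.linearMap_apply]
    by_cases hi : i ∈ S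
    · exact Subtype.val_injective.extend_apply (fun s : S => x s) 0 ⟨i, hi⟩
    · rw [Function.extend_apply' _ _ _ (by rintro ⟨s, rfl⟩; exact hi s.2)]
      by_contra h
      exact hi (hx (Ne.symm h))

theorem hasTameImages_Δ (S : Finset (Fin m)) : HasTameImages (Δ S) := by
  rw [← range_extendZero]
  exact .submodule _

theorem hasTameImages_compl_Δ {S : Finset (Fin m)} (hS : S.card + 2 ≤ m) :
    HasTameImages (Δ S)ᶜ := by
  rw [← range_extendZero]
  refine .compl_submodule _ ?_
  have := LinearMap.finrank_range_le (extendZero S)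
  simp at this ⊢
  omega

/-- The parametrisation of `b₁ Δ_X + b₂ Δ_Y + b₃ Δ_Z + b₄ Δ_W`. -/
def combineExtend (X Y Z W : Finset (Fin m)) :
    (X → ZMod 2) × (Y → ZMod 2) × (Z → ZMod 2) × (W → ZMod 2) →ₗ[ZMod 2] (Fin m → 𝓡) :=
  combineMap m ∘ₗ (extendZero X).prodMap
    ((extendZero Y).prodMap ((extendZero Z).prodMap (extendZero W)))

theorem combineExtend_injective (X Y Z W : Finset (Fin m)) :
    Function.Injective (combineExtend X Y Z W) :=
  combineMap_injective.comp ((extendZero_injective X).prodMap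
    ((extendZero_injective Y).prodMap ((extendZero_injective Z).prodMap (extendZero_injective W))))

theorem range_combineExtend (X Y Z W : Finset (Fin m)) :
    (LinearMap.range (combineExtend X Y Z W) : Set (Fin m → 𝓡)) =
      combine (Δ X) (Δ Y) (Δ Z) (Δ W) := by
  rw [combine_eq_image, ← range_extendZero, ← range_extendZero, ← range_extendZero,
    ← range_extendZero, combineExtend, LinearMap.range_comp, Submodule.map_coe]
  simp only [LinearMap.coe_range, LinearMap.coe_prodMap, Set.range_prodMap]

theorem finrank_combineExtend_domain (X Y Z W : Finset (Fin m)) :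
    Module.finrank (ZMod 2) ((X → ZMod 2) × (Y → ZMod 2) × (Z → ZMod 2) × (W → ZMod 2)) =
      X.card + Y.card + Z.card + W.card := by
  simp [add_assoc]

theorem hasTameImages_compl_combine_Δ {X Y Z W : Finset (Fin m)}
    (h : X.card + Y.card + Z.card + W.card + 2 ≤ 4 * m) :
    HasTameImages (combine (Δ X) (Δ Y) (Δ Z) (Δ W))ᶜ := by
  rw [← range_combineExtend]
  refine .compl_submodule _ ?_
  have := LinearMap.finrank_range_le (combineExtend X Y Z W)
  rw [finrank_combineExtend_domain] at this
  rw [finrank_pi_ring]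
  omega

theorem compl_add_mem {E : Type*} [AddCommGroup E] [Module (ZMod 2) E] (U : Submodule (ZMod 2) E) :
    ∀ x ∈ (U : Set E)ᶜ, ∀ y ∈ (U : Set E), x + y ∈ (U : Set E)ᶜ :=
  fun _ hx _ hy h => hx ((U.add_mem_iff_left hy).1 h)

theorem Δ_add_mem (S : Finset (Fin m)) : ∀ x ∈ Δ S, ∀ y ∈ Δ S, x + y ∈ Δ S := by
  rw [← range_extendZero]
  exact fun x hx y hy => Submodule.add_mem _ hx hy

theorem compl_Δ_add_mem (S : Finset (Fin m)) : ∀ x ∈ (Δ S)ᶜ, ∀ y ∈ Δ S, x + y ∈ (Δ S)ᶜ := by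
  rw [← range_extendZero]
  exact compl_add_mem _

theorem combine_add_mem {A₁ A₂ A₃ A₄ B₁ B₂ B₃ B₄ : Set (Fin m → ZMod 2)}
    (h₁ : ∀ x ∈ A₁, ∀ y ∈ B₁, x + y ∈ A₁) (h₂ : ∀ x ∈ A₂, ∀ y ∈ B₂, x + y ∈ A₂)
    (h₃ : ∀ x ∈ A₃, ∀ y ∈ B₃, x + y ∈ A₃) (h₄ : ∀ x ∈ A₄, ∀ y ∈ B₄, x + y ∈ A₄) :
    ∀ x ∈ combine A₁ A₂ A₃ A₄, ∀ y ∈ combine B₁ B₂ B₃ B₄, x + y ∈ combine A₁ A₂ A₃ A₄ := by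
  simp only [combine_eq_image]
  rintro _ ⟨x, hx, rfl⟩ _ ⟨y, hy, rfl⟩
  exact ⟨x + y, ⟨h₁ _ hx.1 _ hy.1, h₂ _ hx.2.1 _ hy.2.1, h₃ _ hx.2.2.1 _ hy.2.2.1,
    h₄ _ hx.2.2.2 _ hy.2.2.2⟩, map_add _ _ _⟩

theorem compl_combine_Δ_add_mem (X Y Z W : Finset (Fin m)) :
    ∀ x ∈ (combine (Δ X) (Δ Y) (Δ Z) (Δ W))ᶜ, ∀ y ∈ combine (Δ X) (Δ Y) (Δ Z) (Δ W),
      x + y ∈ (combine (Δ X) (Δ Y) (Δ Z) (Δ W))ᶜ := by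
  rw [← range_combineExtend]
  exact compl_add_mem _

end Combine

/-! ### From the subfield code to functionals -/

section SubfieldCode

variable {m n k : ℕ} {d : Fin n → Fin m → 𝓡} {G : Matrix (Fin k) (Fin n) 𝓡} {ι : Type*}
  {B : Module.Basis ι (ZMod 2) 𝓡}

/-- Codewords of the subfield code are given by evaluating `𝔽₂`-linear functionals. -/
theorem exists_functional_of_mem_subfieldCode (hG : IsGeneratorMatrix G (codeOf d)) :
    ∀ c ∈ subfieldCode B G, ∃ L : (Fin m → 𝓡) →ₗ[ZMod 2] ZMod 2, c = fun j => L (d j) := by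
  let ev : ((Fin m → 𝓡) →ₗ[ZMod 2] ZMod 2) →ₗ[ZMod 2] (Fin n → ZMod 2) :=
    LinearMap.pi fun j => LinearMap.applyₗ (d j)
  suffices h : subfieldCode B G ≤ LinearMap.range ev by
    intro c hc
    obtain ⟨L, rfl⟩ := h hc
    exact ⟨L, rfl⟩
  refine Submodule.span_le.2 ?_
  rintro _ ⟨⟨r, i⟩, rfl⟩
  have hr : G r ∈ codeOf d := by
    rw [← hG]
    exact Submodule.subset_span ⟨r, rfl⟩
  obtain ⟨z, hz⟩ := hr
  -- Row r of G is (z·d_j)_j, so its i-th coordinate row is the i-th coordinate functional applied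
  -- to z·d_j.
  refine ⟨B.coord i ∘ₗ (dotProductBilin (ZMod 2) (ZMod 2) z), ?_⟩
  funext j
  simp only [hz]
  rfl

theorem isMinimalCode_subfieldCode {D : Set (Fin m → 𝓡)} (hd : IsEnumeration d D)
    (hG : IsGeneratorMatrix G (codeOf d)) (hD : HasTameImages D) :
    IsMinimalCode (subfieldCode B G) :=
  isMinimalCode_of_hasTameImages (exists_functional_of_mem_subfieldCode hG) (hd.2 ▸ hD)

theorem isSelfOrthogonal_subfieldCode {D : Set (Fin m → 𝓡)} (hd : IsEnumeration d D)
    (hG : IsGeneratorMatrix G (codeOf d)) {X Y Z W : Finset (Fin m)}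
    (hcard : 3 ≤ X.card + Y.card + Z.card + W.card)
    (hD : ∀ x ∈ D, ∀ y ∈ combine (Δ X) (Δ Y) (Δ Z) (Δ W), x + y ∈ D) :
    IsSelfOrthogonal (subfieldCode B G) := by
  refine isSelfOrthogonal_of_add_mem (exists_functional_of_mem_subfieldCode hG) hd.1
    (by rwa [finrank_combineExtend_domain]) (combineExtend X Y Z W)
    (combineExtend_injective X Y Z W) ?_
  rw [hd.2]
  exact fun x hx y => hD x hx _ (range_combineExtend X Y Z W ▸ ⟨y, rfl⟩)

end SubfieldCode

end

end SubfieldCodes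

open SubfieldCodes

theorem theorem4p3 {m : ℕ} (hm : 0 < m) (X Y Z W : Finset (Fin m))
    (D : Set (Fin m → 𝓡))
    {n : ℕ} (d : Fin n → Fin m → 𝓡) (hd : IsEnumeration d D)
    {k : ℕ} (G : Matrix (Fin k) (Fin n) 𝓡) (hG : IsGeneratorMatrix G (codeOf d))
    {ι : Type*} (B : Module.Basis ι (ZMod 2) 𝓡)
    (C : Submodule (ZMod 2) (Fin n → ZMod 2)) (hC : C = subfieldCode B G) :
    (D = combine (Δ X) (Δ Y) (Δ Z) (Δ W) →
      IsMinimalCode C ∧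
      (3 ≤ X.card + Y.card + Z.card + W.card → IsSelfOrthogonal C)) ∧
    (D = combine (Δ X)ᶜ (Δ Y) (Δ Z) (Δ W) →
      (X.card + 2 ≤ m → IsMinimalCode C) ∧
      (3 ≤ Y.card + Z.card + W.card → IsSelfOrthogonal C)) ∧
    (D = combine (Δ X) (Δ Y)ᶜ (Δ Z) (Δ W) →
      (Y.card + 2 ≤ m → IsMinimalCode C) ∧
      (3 ≤ X.card + Z.card + W.card → IsSelfOrthogonal C)) ∧
    (D = combine (Δ X) (Δ Y) (Δ Z)ᶜ (Δ W) →
      (Z.card + 2 ≤ m → IsMinimalCode C) ∧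
      (3 ≤ X.card + Y.card + W.card → IsSelfOrthogonal C)) ∧
    (D = combine (Δ X) (Δ Y) (Δ Z) (Δ W)ᶜ →
      (W.card + 2 ≤ m → IsMinimalCode C) ∧
      (3 ≤ X.card + Y.card + Z.card → IsSelfOrthogonal C)) ∧
    (D = combine (Δ X)ᶜ (Δ Y)ᶜ (Δ Z) (Δ W) →
      (max X.card Y.card + 2 ≤ m → IsMinimalCode C) ∧
      (3 ≤ Z.card + W.card → IsSelfOrthogonal C)) ∧
    (D = combine (Δ X)ᶜ (Δ Y) (Δ Z)ᶜ (Δ W) →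
      (max X.card Z.card + 2 ≤ m → IsMinimalCode C) ∧
      (3 ≤ Y.card + W.card → IsSelfOrthogonal C)) ∧
    (D = combine (Δ X)ᶜ (Δ Y) (Δ Z) (Δ W)ᶜ →
      (max X.card W.card + 2 ≤ m → IsMinimalCode C) ∧
      (3 ≤ Y.card + Z.card → IsSelfOrthogonal C)) ∧
    (D = combine (Δ X) (Δ Y)ᶜ (Δ Z)ᶜ (Δ W) →
      (max Y.card Z.card + 2 ≤ m → IsMinimalCode C) ∧
      (3 ≤ X.card + W.card → IsSelfOrthogonal C)) ∧
    (D = combine (Δ X) (Δ Y)ᶜ (Δ Z) (Δ W)ᶜ →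
      (max Y.card W.card + 2 ≤ m → IsMinimalCode C) ∧
      (3 ≤ X.card + Z.card → IsSelfOrthogonal C)) ∧
    (D = combine (Δ X) (Δ Y) (Δ Z)ᶜ (Δ W)ᶜ →
      (max Z.card W.card + 2 ≤ m → IsMinimalCode C) ∧
      (3 ≤ X.card + Y.card → IsSelfOrthogonal C)) ∧
    (D = combine (Δ X)ᶜ (Δ Y)ᶜ (Δ Z)ᶜ (Δ W) →
      (max (max X.card Y.card) Z.card + 2 ≤ m → IsMinimalCode C) ∧
      (3 ≤ W.card → IsSelfOrthogonal C)) ∧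
    (D = combine (Δ X)ᶜ (Δ Y)ᶜ (Δ Z) (Δ W)ᶜ →
      (max (max X.card Y.card) W.card + 2 ≤ m → IsMinimalCode C) ∧
      (3 ≤ Z.card → IsSelfOrthogonal C)) ∧
    (D = combine (Δ X)ᶜ (Δ Y) (Δ Z)ᶜ (Δ W)ᶜ →
      (max (max X.card Z.card) W.card + 2 ≤ m → IsMinimalCode C) ∧
      (3 ≤ Y.card → IsSelfOrthogonal C)) ∧
    (D = combine (Δ X) (Δ Y)ᶜ (Δ Z)ᶜ (Δ W)ᶜ →
      (max (max Y.card Z.card) W.card + 2 ≤ m → IsMinimalCode C) ∧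
      (3 ≤ X.card → IsSelfOrthogonal C)) ∧
    (D = combine (Δ X)ᶜ (Δ Y)ᶜ (Δ Z)ᶜ (Δ W)ᶜ →
      (max (max (max X.card Y.card) Z.card) W.card + 2 ≤ m → IsMinimalCode C) ∧
      (X.Nonempty ∧ Y.Nonempty ∧ Z.Nonempty ∧ W.Nonempty → IsSelfOrthogonal C)) ∧
    (D = (combine (Δ X) (Δ Y) (Δ Z) (Δ W))ᶜ →
      (X.card + Y.card + Z.card + W.card + 2 ≤ 4 * m → IsMinimalCode C) ∧
      (3 ≤ X.card + Y.card + Z.card + W.card → IsSelfOrthogonal C)) := by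
  subst hC
  refine ⟨?_, ?_, ?_, ?_, ?_, ?_, ?_, ?_, ?_, ?_, ?_, ?_, ?_, ?_, ?_, ?_, ?_⟩
  · rintro rfl
    exact ⟨isMinimalCode_subfieldCode hd hG (.combine (hasTameImages_Δ _) (hasTameImages_Δ _)
      (hasTameImages_Δ _) (hasTameImages_Δ _)), fun h =>
      isSelfOrthogonal_subfieldCode hd hG h (combine_add_mem (Δ_add_mem _) (Δ_add_mem _)
      (Δ_add_mem _) (Δ_add_mem _))⟩
  on_goal 16 =>
    rintro rfl
    exact ⟨fun h => isMinimalCode_subfieldCode hd hG (hasTameImages_compl_combine_Δ h),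
      fun h => isSelfOrthogonal_subfieldCode hd hG h (compl_combine_Δ_add_mem X Y Z W)⟩
  -- Complemented factors are also stable under their Δ, so all four sets contribute translations
  -- and the stated bounds suffice a fortiori.
  all_goals
    rintro rfl
    refine ⟨fun h => isMinimalCode_subfieldCode hd hG (.combine ?_ ?_ ?_ ?_), fun h =>
      isSelfOrthogonal_subfieldCode (X := X) (Y := Y) (Z := Z) (W := W) hd hG ?_
        (combine_add_mem ?_ ?_ ?_ ?_)⟩
    any_goals first
      | exact hasTameImages_Δ _
      | exact hasTameImages_compl_Δ (by omega)
      | exact Δ_add_mem _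
      | exact compl_Δ_add_mem _
      | omega
  -- Only the fully complemented case is left: four nonempty sets give dimension at least 4.
  simp only [← Finset.card_pos] at h
  omega
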